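/- **Notation.** Let $\mathbb S=\{I\in\mathbb H: I^2=-1\}$, and for $I\in\mathbb S$, $z=\alpha+\imath\beta\in\mathbb C$ put $\phi_I(z)=\alpha+\beta I$. For $x=\alpha+\beta I\in\mathbb H$ let $\mathbb S_x=\alpha+\beta\,\mathbb S$; the symmetric completion of $T\subseteq\mathbb H$ is $\widetilde T=\bigcup_{x\in T}\mathbb S_x$. The circularization of $E\subseteq\mathbb C$ is $\Omega_E=\bigcup_{I\in\mathbb S}\phi_I(E)$. Let $\mathbb H_{\mathbb C}=\mathbb H+\imath\,\mathbb H$, with $\overline{x+\imath y}=x-\imath y$ and $\phi_I(x+\imath y)=x+Iy$. A function $f$ on an open set $U\subseteq\mathbb H$ is *slice regular* if for every $I\in\mathbb S$ the function $f\circ\phi_I$ is $\mathscr C^1$ on $\phi_I^{-1}(U)$ with $\frac12(\partial_\alpha+I\,\partial_\beta)(f\circ\phi_I)=0$ there. For a nonempty open $D\subseteq\mathbb C$ invariant under conjugation, a *holomorphic stem function* $F:D\to\mathbb H_{\mathbb C}$ is a $\mathscr C^1$ function with $\partial_\beta F=\imath\,\partial_\alpha F$ and $F(\bar z)=\overline{F(z)}$;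 it induces the function $\mathcal I(F):\Omega_D\to\mathbb H$, $\mathcal I(F)(\phi_J(z))=\phi_J(F(z))$ for $z\in D$, $J\in\mathbb S$. **Hinged domains.** Let $\Omega\subseteq\mathbb H$ be a domain (nonempty, open, connected). For $J\in\mathbb S$ put $E^J=\{z\in\mathbb C:\operatorname{Im}z\ge 0,\ \phi_J(z)\in\Omega\}$. $\Omega$ is *speared* if for each $J\in\mathbb S$ every connected component of $\phi_J(E^J)$ includes a real point. For points $x_0=\phi_{J_0}(z)$, $x_1=\phi_{J_1}(z)$, $y_0=\phi_{J_0}(w)$, $y_1=\phi_{J_1}(w)$ of $\Omega$ with $\operatorname{Im}z,\operatorname{Im}w\ge0$, say that $(x_1,y_1)$ *shadows* $(x_0,y_0)$ if there is a path from $z$ to $w$ in $E^{J_0}\cap E^{J_1}$; $x_1$ is *strongly hinged* to $x_0$ if $(x_1,y)$ shadows $(x_0,y)$ for some $y\in\Omega\cap\mathbb R$. In a finite sequence $x_0,\dots,x_t$ in $\Omega$ ($t\geq1$), there is a *simple step* at $s<t$ if $x_{s+1}$ lies in the connected component of $\mathbb S_{x_s}\cap\Omega$ containing $x_s$, or $x_{s+1}$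 is strongly hinged to $x_s$; for $a+2\le b<t$ there is a *double step* at $(a,b)$ if the steps at $a$ and $b$ are not both simple and $(x_{b+1},x_b)$ shadows $(x_a,x_{a+1})$. The sequence is a *chain* connecting $x_0$ and $x_t$ if the indices $s<t$ at which there is no simple step can be listed without repetition as $a_1,b_1,\dots,a_\ell,b_\ell$ with a double step at each $(a_m,b_m)$, $a_1<\dots<a_\ell$, and, whenever $m<n$, either $b_m<a_n$ or $b_n<b_m$. A speared domain $\Omega$ is *hinged* if for all $x\in\Omega$ and $x'\in\mathbb S_x\cap\Omega$ some chain connects $x$ and $x'$. **The stem family.** For $f:\Omega\to\mathbb H$ slice regular on a speared domain $\Omega$, let $D^J=E^J\cup\overline{E^J}$ and, for distinct $J,K\in\mathbb S$, let $D^{J,K}=(E^J\cap E^K)\cup\overline{E^J\cap E^K}$ and let $F^{J,K}:D^{J,K}\to\mathbb H_{\mathbb C}$ be given by $$F^{J,K}(z)=(J-K)^{-1}[Jf(\phi_J(z))-Kf(\phi_K(z))]+\imath\,(J-K)^{-1}[f(\phi_J(z))-f(\phi_K(z))]$$ for $z\in E^J\cap E^K$ and $F^{J,K}(\bar z)=\overline{F^{J,K}(z)}$.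 The *holomorphic stem family* of $f$ is the family of holomorphic stem functions $F^J:D^J\to\mathbb H_{\mathbb C}$, $J\in\mathbb S$, determined by the following property: each $z\in D^J$ has an open neighbourhood $U\subseteq D^J$ and an $\varepsilon>0$ such that, for all distinct $J',K'\in\mathbb S$ at distance less than $\varepsilon$ from $J$, $U\subseteq D^{J',K'}$ and $F^{J',K'}=F^J$ on $U$. **Theorem (Global extension for hinged domains).** Let $\Omega\subseteq\mathbb H$ be a hinged domain and let $f:\Omega\to\mathbb H$ be slice regular. Then there exists a unique slice regular function $\widetilde f:\widetilde\Omega\to\mathbb H$ on the symmetric completion $\widetilde\Omega$ (an open set) that extends $f$. Moreover, the holomorphic stem family $\{F^J\}_{J\in\mathbb S}$ of $f$ exists; setting $D=\bigcup_{J\in\mathbb S}D^J$, one has $\Omega_D=\widetilde\Omega$, and there is a holomorphic stem function $F:D\to\mathbb H_{\mathbb C}$ with $F|_{D^J}=F^J$ for all $J\in\mathbb S$ and $\widetilde f=\mathcal I(F)$. -/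

import Mathlib

open scoped Quaternion

namespace SliceRegular

noncomputable section

/-! ### Quaternions, slices, axial symmetry -/

/-- The 2-sphere of quaternionic imaginary units. -/
def imaginaryUnits : Set ℍ := {I | I ^ 2 = -1}

/-- `phi I (α + iβ) = α + β I`. -/
def phi (I : ℍ) (z : ℂ) : ℍ := (z.re : ℍ) + (z.im : ℍ) * I

/-- The closed half-slice `T ∩ {α + β I : α, β real, 0 ≤ β}`. -/
def halfSlice (T : Set ℍ) (I : ℍ) : Set ℍ :=
  T ∩ {x | ∃ z : ℂ, 0 ≤ z.im ∧ x = phi I z}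

/-- The sphere `α + β 𝕊` through `x = α + β I`. -/
def sphereThrough (x : ℍ) : Set ℍ :=
  {y | ∃ z : ℂ, ∃ I ∈ imaginaryUnits, ∃ J ∈ imaginaryUnits, x = phi I z ∧ y = phi J z}

/-- The symmetric completion of `T`: the union of the spheres through the points of `T`. -/
def symmetricCompletion (T : Set ℍ) : Set ℍ := ⋃ x ∈ T, sphereThrough x

/-- The circularization of `E ⊆ ℂ`. -/
def circularization (E : Set ℂ) : Set ℍ :=
  {x | ∃ z ∈ E, ∃ I ∈ imaginaryUnits, x = phi I z}

/-- A domain of `ℍ`: a nonempty connected open subset. -/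
def IsQuaternionicDomain (Ω : Set ℍ) : Prop := IsOpen Ω ∧ IsConnected Ω

/-! ### Slice regular functions -/

/-- The operator `½ (∂/∂α + I ∂/∂β)` applied to `f` restricted to the slice of `I`,
at the point `α + β I`, where `z = α + iβ`. -/
def dbar (I : ℍ) (f : ℍ → ℍ) (z : ℂ) : ℍ :=
  (1 / 2 : ℝ) • (fderiv ℝ (f ∘ phi I) z 1 + I * fderiv ℝ (f ∘ phi I) z Complex.I)

/-- `f` is slice regular on the open set `U`: its restriction to every slice of `U` is `C¹` and is
annihilated by the Cauchy-Riemann operator of that slice. Only the values of `f` on `U` matter. -/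
structure IsSliceRegularOn (f : ℍ → ℍ) (U : Set ℍ) : Prop where
  isOpen : IsOpen U
  contDiffOn : ∀ I ∈ imaginaryUnits, ContDiffOn ℝ 1 (f ∘ phi I) (phi I ⁻¹' U)
  dbar_eq_zero : ∀ I ∈ imaginaryUnits, ∀ z ∈ phi I ⁻¹' U, dbar I f z = 0

/-! ### Speared domains and hinged domains -/

/-- `U` is a speared open set: every connected component of every closed half-slice of `U` includes
a real point. -/
def IsSpearedOpen (U : Set ℍ) : Prop :=
  IsOpen U ∧ ∀ I ∈ imaginaryUnits, ∀ x ∈ halfSlice U I,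
    ∃ r : ℝ, (r : ℍ) ∈ connectedComponentIn (halfSlice U I) x

/-- A speared domain is a domain that is a speared open set. -/
def IsSpearedDomain (Ω : Set ℍ) : Prop := IsQuaternionicDomain Ω ∧ IsSpearedOpen Ω

/-- The preimage under `phi J` of the closed half-slice of `Ω` (a subset of the closed upper
half-plane). -/
def halfPreimage (Ω : Set ℍ) (J : ℍ) : Set ℂ := {z | 0 ≤ z.im ∧ phi J z ∈ Ω}

/-- `(x₁, y₁)` shadows `(x₀, y₀)` in `Ω`. (That the four points belong to `Ω` and that `z`, `w` have
nonnegative imaginary parts is part of the existence of the path.) -/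
def Shadows (Ω : Set ℍ) (x₁ y₁ x₀ y₀ : ℍ) : Prop :=
  ∃ J₀ ∈ imaginaryUnits, ∃ J₁ ∈ imaginaryUnits, ∃ z w : ℂ,
    x₀ = phi J₀ z ∧ x₁ = phi J₁ z ∧ y₀ = phi J₀ w ∧ y₁ = phi J₁ w ∧
      JoinedIn (halfPreimage Ω J₀ ∩ halfPreimage Ω J₁) z w

/-- `x₁` is strongly hinged to `x₀` in `Ω`. -/
def StronglyHinged (Ω : Set ℍ) (x₁ x₀ : ℍ) : Prop :=
  ∃ r : ℝ, (r : ℍ) ∈ Ω ∧ Shadows Ω x₁ r x₀ r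

/-- There is a simple step at `s` in the sequence `x`. (Both alternatives are symmetric in the two
points, so only one order has to be considered.) -/
def SimpleStep (Ω : Set ℍ) (x : ℕ → ℍ) (s : ℕ) : Prop :=
  x (s + 1) ∈ connectedComponentIn (sphereThrough (x s) ∩ Ω) (x s) ∨
    StronglyHinged Ω (x (s + 1)) (x s)

/-- There is a double step at `(a, b)` in the sequence `x₀, …, x_t`: the pairs of indices
`{a, a + 1}` and `{b, b + 1}` are disjoint, the second after the first, they are not
simple steps, and `(x_{b+1}, x_b)` shadows `(x_a, x_{a+1})`. (Shadowing is symmetric and invariant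
under swapping both pairs, so it does not matter which pair of indices is considered first.) -/
def DoubleStep (Ω : Set ℍ) (t : ℕ) (x : ℕ → ℍ) (a b : ℕ) : Prop :=
  a + 2 ≤ b ∧ b + 1 ≤ t ∧ (¬ SimpleStep Ω x a ∨ ¬ SimpleStep Ω x b) ∧
    Shadows Ω (x (b + 1)) (x b) (x a) (x (a + 1))

/-- `x₀, …, x_t` is a chain of length `t` in `Ω`: the indices `s < t` at which no simple step
happens can be listed without repetition as `a₁, b₁, …, a_ℓ, b_ℓ`, with a double step at each
`(a_m, b_m)`, with `a₁ < … < a_ℓ`, and with no two double steps intertwined. -/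
def IsHingeChain (Ω : Set ℍ) (t : ℕ) (x : ℕ → ℍ) : Prop :=
  1 ≤ t ∧ (∀ s ≤ t, x s ∈ Ω) ∧
    ∃ (l : ℕ) (a b : Fin l → ℕ),
      Function.Injective (Sum.elim a b) ∧
      Set.range (Sum.elim a b) = {s | s < t ∧ ¬ SimpleStep Ω x s} ∧
      (∀ m, DoubleStep Ω t x (a m) (b m)) ∧
      StrictMono a ∧
      ∀ m n, m < n → b m < a n ∨ b n < b m

/-- `x'` is hinged to `x` in `Ω`: some chain connects `x` and `x'`. -/
def Hinged (Ω : Set ℍ) (x x' : ℍ) : Prop :=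
  ∃ (t : ℕ) (c : ℕ → ℍ), IsHingeChain Ω t c ∧ c 0 = x ∧ c t = x'

/-- A hinged domain: a speared domain in which any two points of a same sphere are hinged. -/
def IsHingedDomain (Ω : Set ℍ) : Prop :=
  IsSpearedDomain Ω ∧ ∀ x ∈ Ω, ∀ x' ∈ sphereThrough x ∩ Ω, Hinged Ω x x'

/-! ### Stem functions -/

/-- The complexified quaternions `ℍ ⊗ ℂ = {x + ı y : x, y ∈ ℍ}`, as a real normed space; `(x, y)`
stands for `x + ı y`. -/
abbrev ComplexifiedQuaternion : Type := ℍ × ℍ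

/-- Multiplication by `ı`. -/
def iotaMul (w : ComplexifiedQuaternion) : ComplexifiedQuaternion := (-w.2, w.1)

/-- The complex conjugation `x + ı y ↦ x - ı y`. -/
def cconj (w : ComplexifiedQuaternion) : ComplexifiedQuaternion := (w.1, -w.2)

/-- The extended map `phi I`, namely `x + ı y ↦ x + I y`. -/
def phiC (I : ℍ) (w : ComplexifiedQuaternion) : ℍ := w.1 + I * w.2

/-- `F` is a holomorphic stem function on the nonempty open set `D`, preserved by conjugation. -/
structure IsHolomorphicStemOn (F : ℂ → ComplexifiedQuaternion) (D : Set ℂ) : Prop where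
  isOpen : IsOpen D
  nonempty : D.Nonempty
  conj_mem : ∀ z ∈ D, (starRingEnd ℂ) z ∈ D
  map_conj : ∀ z ∈ D, F ((starRingEnd ℂ) z) = cconj (F z)
  contDiffOn : ContDiffOn ℝ 1 F D
  cauchyRiemann : ∀ z ∈ D, fderiv ℝ F z Complex.I = iotaMul (fderiv ℝ F z 1)

/-- On the circularization of `D`, the function `f` is the slice function induced by `F`. -/
def IsInducedBy (f : ℍ → ℍ) (F : ℂ → ComplexifiedQuaternion) (D : Set ℂ) : Prop :=
  ∀ J ∈ imaginaryUnits, ∀ z ∈ D, f (phi J z) = phiC J (F z)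

/-! ### The holomorphic stem families associated to a slice regular function -/

/-- The union of `E` with its image under conjugation. -/
def conjHull (E : Set ℂ) : Set ℂ := E ∪ (starRingEnd ℂ) '' E

/-- The set `D^J`. -/
def stemDomain (Ω : Set ℍ) (J : ℍ) : Set ℂ := conjHull (halfPreimage Ω J)

/-- The set `D^{J,K}`. -/
def stemDomain₂ (Ω : Set ℍ) (J K : ℍ) : Set ℂ :=
  conjHull (halfPreimage Ω J ∩ halfPreimage Ω K)

/-- The formula for `F^{J,K}` in the closed upper half-plane. -/
def upperStem₂ (f : ℍ → ℍ) (J K : ℍ) (z : ℂ) : ComplexifiedQuaternion :=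
  ((J - K)⁻¹ * (J * f (phi J z) - K * f (phi K z)), (J - K)⁻¹ * (f (phi J z) - f (phi K z)))

open Classical in
/-- The function `F^{J,K}` (considered only on `D^{J,K}`, for distinct `J`, `K`). -/
def stem₂ (f : ℍ → ℍ) (J K : ℍ) (z : ℂ) : ComplexifiedQuaternion :=
  if 0 ≤ z.im then upperStem₂ f J K z else cconj (upperStem₂ f J K ((starRingEnd ℂ) z))

/-- `F` is the holomorphic stem family `{F^J}` associated to `f`: each `F^J` is a holomorphic stem
function on `D^J`, and near each point `z` of `D^J` it is the common value of the functions
`F^{J',K'}` for all distinct units `J'`, `K'` close enough to `J`. The latter requirement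
determines `F^J` uniquely on `D^J`. -/
structure IsHolomorphicStemFamily (Ω : Set ℍ) (f : ℍ → ℍ)
    (F : ℍ → ℂ → ComplexifiedQuaternion) : Prop where
  stem : ∀ J ∈ imaginaryUnits, IsHolomorphicStemOn (F J) (stemDomain Ω J)
  spec : ∀ J ∈ imaginaryUnits, ∀ z ∈ stemDomain Ω J,
    ∃ ε > 0, ∃ U : Set ℂ, IsOpen U ∧ z ∈ U ∧ U ⊆ stemDomain Ω J ∧
      ∀ J' ∈ imaginaryUnits, ∀ K' ∈ imaginaryUnits, ‖J' - J‖ < ε → ‖K' - J‖ < ε → J' ≠ K' →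
        U ⊆ stemDomain₂ Ω J' K' ∧ Set.EqOn (stem₂ f J' K') (F J) U

end

end SliceRegular

open SliceRegular

/-!
The stem function of two distinct slices, `F^{J,K}`, is holomorphic with respect to `ı` off the
real axis by a direct computation, and across it by reflection; at real points it takes the value
`(f, 0)`, whatever `J` and `K` are. Since holomorphic maps into `ℍ × ℍ ≅ ℂ⁴` obey the identity
principle (`eqOn_of_eq_on_reals`), two such functions agree on every connected open set that meets
the real axis and lies in both domains. In a speared set, a point of `D^J` is joined to the real
axis by a path in `D^J`, and by compactness a neighbourhood of the path lies in `D^{J'}` for all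
`J'` close to `J` (`exists_tube`). Hence the functions `F^{J',K'}` with `J'`, `K'` close to `J`
have a common value `F^J` near the point, and `F^L = F^J` near it for `L` close to `J`
(`exists_stemFamily_eqOn`).

It remains to see that `F^J = F^K` on `D^J ∩ D^K` in a hinged domain. Attach to each point
`φ_J(z)` of `Ω` the germ of `F^J` at `z`. The germ is locally constant along spheres, and by the
identity principle shadowing transports equality of germs from one pair of points to the other
(`Shadows.sameStemGerm_iff`); strong hinging is the case where the second pair is a single real
point. So simple steps preserve the germ. The double steps of a chain are nested like brackets,
and by induction on the length the germs at the inner points of a double step agree, hence so do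
those at its outer points (`IsHingeChain.sameStemGerm`).

The stem family therefore glues to one holomorphic stem function on the union of the `D^J`, and
the slice function it induces is the extension. Uniqueness is again the identity principle, as any
extension `g` is recovered on the slice of `J` from the stem function of `J` and `-J`.
-/

open scoped Quaternion

open Filter Topology

namespace SliceRegular

noncomputable section

/-! ### Imaginary units and slice coordinates -/

lemma mul_self_of_mem {I : ℍ} (hI : I ∈ imaginaryUnits) : I * I = -1 := by
  have h : I ^ 2 = -1 := hI
  rwa [sq] at h

lemma neg_mem_imaginaryUnits {I : ℍ} (hI : I ∈ imaginaryUnits) : -I ∈ imaginaryUnits := by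
  have h := mul_self_of_mem hI
  change (-I) ^ 2 = -1
  rw [sq, neg_mul_neg, h]

lemma eq_zero_of_eq_neg {x : ℍ} (h : x = -x) : x = 0 := by
  have h2 : (2 : ℝ) • x = 0 := by
    rw [two_smul]
    nth_rewrite 1 [h]
    exact neg_add_cancel x
  exact (smul_eq_zero_iff_right two_ne_zero).1 h2

lemma norm_of_mem {I : ℍ} (hI : I ∈ imaginaryUnits) : ‖I‖ = 1 := by
  have h : ‖I ^ 2‖ = 1 := by rw [show I ^ 2 = -1 from hI, norm_neg, norm_one]
  rw [norm_pow] at h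
  nlinarith [norm_nonneg I]

lemma re_of_mem {I : ℍ} (hI : I ∈ imaginaryUnits) : I.re = 0 := by
  have h := mul_self_of_mem hI
  have h0 := congrArg (fun q : ℍ => q.re) h
  have h1 := congrArg (fun q : ℍ => q.imI) h
  have h2 := congrArg (fun q : ℍ => q.imJ) h
  have h3 := congrArg (fun q : ℍ => q.imK) h
  simp at h0 h1 h2 h3
  by_contra hre
  have e1 : I.imI = 0 := by
    have : I.re * I.imI = 0 := by linarith
    simpa [hre] using this
  have e2 : I.imJ = 0 := by
    have : I.re * I.imJ = 0 := by linarith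
    simpa [hre] using this
  have e3 : I.imK = 0 := by
    have : I.re * I.imK = 0 := by linarith
    simpa [hre] using this
  rw [e1, e2, e3] at h0
  nlinarith [mul_self_nonneg I.re]

/-- The quaternion with the given real components. The ascription to `ℍ` keeps terms in the form
`ℍ` rather than `ℍ[ℝ,-1,-1]`. -/
def ofComponents (a b c d : ℝ) : ℍ := ⟨a, b, c, d⟩

@[simp] lemma ofComponents_re (a b c d : ℝ) : (ofComponents a b c d).re = a := rfl

@[simp] lemma ofComponents_imI (a b c d : ℝ) : (ofComponents a b c d).imI = b := rfl

@[simp] lemma ofComponents_imJ (a b c d : ℝ) : (ofComponents a b c d).imJ = c := rfl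

@[simp] lemma ofComponents_imK (a b c d : ℝ) : (ofComponents a b c d).imK = d := rfl

/-- Every imaginary unit is the limit of distinct imaginary units: rotate it slightly by the inner
automorphism of `1 + t p`, where `p` does not commute with it. -/
lemma exists_unit_near {J : ℍ} (hJ : J ∈ imaginaryUnits) {ε : ℝ} (hε : 0 < ε) :
    ∃ K ∈ imaginaryUnits, K ≠ J ∧ ‖K - J‖ < ε := by
  obtain ⟨p, hp⟩ : ∃ p : ℍ, p * J ≠ J * p := by
    by_contra! hcomm
    have hre := re_of_mem hJ
    have h1 := hcomm (ofComponents 0 1 0 0)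
    have h2 := hcomm (ofComponents 0 0 1 0)
    have a1 := congrArg (fun q : ℍ => q.imJ) h1
    have a2 := congrArg (fun q : ℍ => q.imK) h1
    have a3 := congrArg (fun q : ℍ => q.imK) h2
    simp at a1 a2 a3
    have e1 : J.imI = 0 := by linarith
    have e2 : J.imJ = 0 := by linarith
    have e3 : J.imK = 0 := by linarith
    have : J = 0 := by ext <;> simp [hre, e1, e2, e3]
    have hn := norm_of_mem hJ
    rw [this, norm_zero] at hn
    norm_num at hn
  have hc : ContinuousAt (fun t : ℝ => (1 + t • p) * J * (1 + t • p)⁻¹) 0 := by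
    have h1 : ContinuousAt (fun t : ℝ => (1 : ℍ) + t • p) 0 := by fun_prop
    exact (h1.mul continuousAt_const).mul (h1.inv₀ (by simp))
  have hlim : Tendsto (fun t : ℝ => ‖(1 + t • p) * J * (1 + t • p)⁻¹ - J‖) (𝓝[≠] 0) (𝓝 0) := by
    have : Tendsto (fun t : ℝ => ‖(1 + t • p) * J * (1 + t • p)⁻¹ - J‖) (𝓝 0)
        (𝓝 ‖(1 + (0 : ℝ) • p) * J * (1 + (0 : ℝ) • p)⁻¹ - J‖) :=
      (hc.sub (continuousAt_const (y := J))).norm.tendsto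
    simp only [zero_smul, add_zero, one_mul, inv_one, mul_one, sub_self, norm_zero] at this
    exact this.mono_left nhdsWithin_le_nhds
  have hne : ∀ᶠ t : ℝ in 𝓝[≠] 0, (1 : ℍ) + t • p ≠ 0 := by
    have h1 : ContinuousAt (fun t : ℝ => (1 : ℍ) + t • p) 0 := by fun_prop
    exact (h1.eventually_ne (by simp)).filter_mono nhdsWithin_le_nhds
  obtain ⟨t, ⟨ht, hq⟩, ht0⟩ :=
    (((hlim.eventually_lt_const hε).and hne).and self_mem_nhdsWithin).exists
  refine ⟨_, ?_, ?_, ht⟩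
  · change (_ : ℍ) ^ 2 = -1
    generalize (1 : ℍ) + t • p = q at hq
    calc (q * J * q⁻¹) ^ 2 = q * J * (q⁻¹ * q) * J * q⁻¹ := by rw [sq]; simp only [mul_assoc]
      _ = q * (J * J) * q⁻¹ := by rw [inv_mul_cancel₀ hq]; simp only [mul_assoc, one_mul]
      _ = -1 := by rw [mul_self_of_mem hJ, mul_neg, mul_one, neg_mul, mul_inv_cancel₀ hq]
  · intro h
    have h2 : (1 + t • p) * J = J * (1 + t • p) := by
      have := congrArg (· * (1 + t • p)) h
      simpa only [mul_assoc, inv_mul_cancel₀ hq, mul_one] using this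
    rw [add_mul, mul_add, one_mul, mul_one, add_right_inj, smul_mul_assoc, mul_smul_comm] at h2
    exact hp (smul_right_injective _ ht0 h2)

/-- The folding of the complex plane onto the closed upper half-plane. -/
def fold (z : ℂ) : ℂ := ⟨z.re, |z.im|⟩

lemma fold_of_nonneg {z : ℂ} (hz : 0 ≤ z.im) : fold z = z := by
  simp [fold, abs_of_nonneg hz]

lemma fold_of_nonpos {z : ℂ} (hz : z.im ≤ 0) : fold z = (starRingEnd ℂ) z := by
  apply Complex.ext <;> simp [fold, abs_of_nonpos hz]

lemma fold_im_nonneg (z : ℂ) : 0 ≤ (fold z).im := abs_nonneg _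

lemma fold_conj (z : ℂ) : fold ((starRingEnd ℂ) z) = fold z := by
  simp [fold]

lemma fold_ofReal (r : ℝ) : fold (r : ℂ) = r := fold_of_nonneg (by simp)

lemma continuous_fold : Continuous fold := by
  have : fold = fun z : ℂ => (z.re : ℂ) + (|z.im| : ℝ) * Complex.I := by
    funext z
    apply Complex.ext <;> simp [fold]
  rw [this]
  fun_prop

lemma phi_neg_conj (J : ℍ) (z : ℂ) : phi (-J) ((starRingEnd ℂ) z) = phi J z := by
  simp [phi]

lemma phi_ofReal (J : ℍ) (r : ℝ) : phi J (r : ℂ) = (r : ℍ) := by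
  simp [phi]

lemma continuous_phi_uncurried : Continuous fun p : ℂ × ℍ => phi p.2 p.1 := by
  have h : Continuous fun r : ℝ => (r : ℍ) := Quaternion.continuous_coe
  unfold phi
  exact (h.comp (Complex.continuous_re.comp continuous_fst)).add
    ((h.comp (Complex.continuous_im.comp continuous_fst)).mul continuous_snd)

lemma continuous_phi (J : ℍ) : Continuous (phi J) :=
  continuous_phi_uncurried.comp (Continuous.prodMk_left J)

/-- The point of the closed upper half-plane corresponding to the sphere through `x`. -/
def upperCoord (x : ℍ) : ℂ := ⟨x.re, ‖x.im‖⟩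

open Classical in
/-- An imaginary unit whose closed half-slice contains `x`; the choice at real points is
arbitrary. -/
def unitOf (x : ℍ) : ℍ := if x.im = 0 then ofComponents 0 1 0 0 else ‖x.im‖⁻¹ • x.im

lemma upperCoord_im_nonneg (x : ℍ) : 0 ≤ (upperCoord x).im := norm_nonneg _

lemma continuous_upperCoord : Continuous upperCoord := by
  have : upperCoord = fun x : ℍ => (x.re : ℂ) + (‖x.im‖ : ℝ) * Complex.I := by
    funext x
    apply Complex.ext <;> simp [upperCoord]
  rw [this]
  have h := Quaternion.continuous_re
  have h' := Quaternion.continuous_im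
  fun_prop

lemma im_mul_self (x : ℍ) : x.im * x.im = -((‖x.im‖ ^ 2 : ℝ) : ℍ) := by
  have h : ‖x.im‖ ^ 2 = x.imI ^ 2 + x.imJ ^ 2 + x.imK ^ 2 := by
    rw [sq, ← Quaternion.normSq_eq_norm_mul_self, Quaternion.normSq_def']
    simp
  rw [h]
  ext
  · rw [Quaternion.re_neg, Quaternion.re_coe]
    simp
    ring
  all_goals
    simp only [Quaternion.imI_neg, Quaternion.imI_coe, Quaternion.imJ_neg, Quaternion.imJ_coe,
      Quaternion.imK_neg, Quaternion.imK_coe]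
    simp
    try ring

lemma unitOf_mem (x : ℍ) : unitOf x ∈ imaginaryUnits := by
  unfold unitOf
  split_ifs with h
  · change (_ : ℍ) ^ 2 = -1
    rw [sq]
    ext <;> simp
  · change (_ : ℍ) ^ 2 = -1
    have hn : ‖x.im‖ ≠ 0 := norm_ne_zero_iff.2 h
    rw [sq, smul_mul_smul_comm, im_mul_self, ← Quaternion.coe_neg, Quaternion.smul_coe]
    rw [show ‖x.im‖⁻¹ * ‖x.im‖⁻¹ * -‖x.im‖ ^ 2 = -1 by field_simp]
    simp

lemma phi_unitOf_upperCoord (x : ℍ) : phi (unitOf x) (upperCoord x) = x := by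
  unfold unitOf
  split_ifs with h
  · simp only [phi, upperCoord, h, norm_zero]
    have := Quaternion.re_add_im x
    rw [h, add_zero] at this
    simpa using this
  · have hn : ‖x.im‖ ≠ 0 := norm_ne_zero_iff.2 h
    simp only [phi, upperCoord]
    rw [Quaternion.coe_mul_eq_smul, smul_smul, mul_inv_cancel₀ hn, one_smul]
    exact Quaternion.re_add_im x

lemma phi_re {J : ℍ} (hJ : J ∈ imaginaryUnits) (z : ℂ) : (phi J z).re = z.re := by
  simp [phi, re_of_mem hJ]

lemma phi_im {J : ℍ} (hJ : J ∈ imaginaryUnits) (z : ℂ) : (phi J z).im = z.im • J := by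
  have h := re_of_mem hJ
  ext <;> simp [phi, h]

lemma upperCoord_phi {J : ℍ} (hJ : J ∈ imaginaryUnits) (z : ℂ) :
    upperCoord (phi J z) = fold z := by
  simp [upperCoord, fold, phi_re hJ, phi_im hJ, norm_smul, norm_of_mem hJ]

lemma unitOf_phi {J : ℍ} (hJ : J ∈ imaginaryUnits) {z : ℂ} (hz : 0 < z.im) :
    unitOf (phi J z) = J := by
  have h0 : J ≠ 0 := norm_ne_zero_iff.1 (by rw [norm_of_mem hJ]; norm_num)
  have : z.im • J ≠ 0 := smul_ne_zero hz.ne' h0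
  rw [unitOf, if_neg (by rwa [phi_im hJ]), phi_im hJ, norm_smul, norm_of_mem hJ, mul_one,
    Real.norm_of_nonneg hz.le, smul_smul, inv_mul_cancel₀ hz.ne', one_smul]

lemma mem_sphereThrough_iff {x y : ℍ} : y ∈ sphereThrough x ↔ upperCoord y = upperCoord x := by
  constructor
  · rintro ⟨z, I, hI, J, hJ, rfl, rfl⟩
    rw [upperCoord_phi hI, upperCoord_phi hJ]
  · intro h
    refine ⟨upperCoord x, unitOf x, unitOf_mem x, unitOf y, unitOf_mem y,
      (phi_unitOf_upperCoord x).symm, ?_⟩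
    rw [← h, phi_unitOf_upperCoord]

/-! ### Holomorphy with respect to `ı` and the identity principle -/

/-- A real coordinate change `ℍ × ℍ ≃ ℂ⁴` under which `iotaMul` becomes multiplication by the
imaginary unit of `ℂ`. -/
def toComplexCoords : ComplexifiedQuaternion ≃L[ℝ] (Fin 4 → ℂ) :=
  LinearEquiv.toContinuousLinearEquiv
    { toFun := fun w => ![⟨w.1.re, w.2.re⟩, ⟨w.1.imI, w.2.imI⟩, ⟨w.1.imJ, w.2.imJ⟩,
        ⟨w.1.imK, w.2.imK⟩]
      map_add' := fun v w => by
        funext i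
        fin_cases i <;> apply Complex.ext <;> simp
      map_smul' := fun c w => by
        funext i
        fin_cases i <;> apply Complex.ext <;> simp
      invFun := fun v => (ofComponents (v 0).re (v 1).re (v 2).re (v 3).re,
        ofComponents (v 0).im (v 1).im (v 2).im (v 3).im)
      left_inv := fun w => by
        refine Prod.ext ?_ ?_ <;> ext <;> simp
      right_inv := fun v => by
        funext i
        fin_cases i <;> simp }

lemma toComplexCoords_iotaMul (w : ComplexifiedQuaternion) :
    toComplexCoords (iotaMul w) = Complex.I • toComplexCoords w := by
  funext i
  fin_cases i <;> apply Complex.ext <;> simp [toComplexCoords, iotaMul]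

/-- The real differentiability and the Cauchy–Riemann equation of a map into the complexified
quaternions at a point. -/
def IsIotaHolomorphicAt (G : ℂ → ComplexifiedQuaternion) (z : ℂ) : Prop :=
  DifferentiableAt ℝ G z ∧ fderiv ℝ G z Complex.I = iotaMul (fderiv ℝ G z 1)

lemma isIotaHolomorphicAt_iff {G : ℂ → ComplexifiedQuaternion} {z : ℂ} :
    IsIotaHolomorphicAt G z ↔ DifferentiableAt ℂ (toComplexCoords ∘ G) z := by
  rw [differentiableAt_complex_iff_differentiableAt_real,
    ContinuousLinearEquiv.comp_differentiableAt_iff, ContinuousLinearEquiv.comp_fderiv]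
  simp only [ContinuousLinearMap.comp_apply, ContinuousLinearEquiv.coe_coe,
    ← toComplexCoords_iotaMul, toComplexCoords.injective.eq_iff]
  rfl

lemma IsIotaHolomorphicAt.of_hasFDerivAt {G : ℂ → ComplexifiedQuaternion} {z : ℂ}
    {A : ℂ →L[ℝ] ComplexifiedQuaternion} (hA : HasFDerivAt G A z)
    (h : A Complex.I = iotaMul (A 1)) : IsIotaHolomorphicAt G z :=
  ⟨hA.differentiableAt, by rwa [hA.fderiv]⟩

lemma IsIotaHolomorphicAt.congr {G H : ℂ → ComplexifiedQuaternion} {z : ℂ}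
    (hG : IsIotaHolomorphicAt G z) (h : H =ᶠ[𝓝 z] G) : IsIotaHolomorphicAt H z :=
  ⟨hG.1.congr_of_eventuallyEq h, by rw [h.fderiv_eq]; exact hG.2⟩

lemma IsIotaHolomorphicAt.conj {G : ℂ → ComplexifiedQuaternion} {z : ℂ}
    (hG : IsIotaHolomorphicAt G ((starRingEnd ℂ) z)) :
    IsIotaHolomorphicAt (fun w => cconj (G ((starRingEnd ℂ) w))) z := by
  have h1 : HasFDerivAt (fun w : ℂ => G ((starRingEnd ℂ) w)) _ z :=
    HasFDerivAt.comp z hG.1.hasFDerivAt Complex.conjCLE.hasFDerivAt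
  have h2 := h1.fst.prodMk h1.snd.neg
  refine .of_hasFDerivAt h2 ?_
  have h3 := hG.2
  simp only [iotaMul, Prod.ext_iff] at h3
  simp [iotaMul, h3.1, h3.2]

lemma contDiffOn_of_isIotaHolomorphicAt {G : ℂ → ComplexifiedQuaternion} {W : Set ℂ}
    (hW : IsOpen W) (hG : ∀ z ∈ W, IsIotaHolomorphicAt G z) : ContDiffOn ℝ 1 G W := by
  rw [← toComplexCoords.comp_contDiffOn_iff]
  have h : DifferentiableOn ℂ (toComplexCoords ∘ G) W := fun z hz =>
    (isIotaHolomorphicAt_iff.1 (hG z hz)).differentiableWithinAt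
  exact (h.contDiffOn hW).restrict_scalars ℝ

lemma analyticOnNhd_toComplexCoords {G : ℂ → ComplexifiedQuaternion} {W : Set ℂ}
    (hW : IsOpen W) (hG : ∀ z ∈ W, IsIotaHolomorphicAt G z) :
    AnalyticOnNhd ℂ (toComplexCoords ∘ G) W :=
  DifferentiableOn.analyticOnNhd (fun z hz =>
    (isIotaHolomorphicAt_iff.1 (hG z hz)).differentiableWithinAt) hW

lemma eqOn_of_eventuallyEq {G H : ℂ → ComplexifiedQuaternion} {W : Set ℂ} (hW : IsOpen W)
    (hc : IsPreconnected W) (hG : ∀ z ∈ W, IsIotaHolomorphicAt G z)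
    (hH : ∀ z ∈ W, IsIotaHolomorphicAt H z) {z₀ : ℂ} (hz₀ : z₀ ∈ W) (h : G =ᶠ[𝓝 z₀] H) :
    Set.EqOn G H W := fun _ hz =>
  toComplexCoords.injective <|
    (analyticOnNhd_toComplexCoords hW hG).eqOn_of_preconnected_of_eventuallyEq
      (analyticOnNhd_toComplexCoords hW hH) hc hz₀ (h.fun_comp toComplexCoords) hz

/-- The identity principle on a domain that meets the real axis, for maps that agree on it. -/
lemma eqOn_of_eq_on_reals {G H : ℂ → ComplexifiedQuaternion} {W : Set ℂ} (hW : IsOpen W)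
    (hc : IsPreconnected W) (hG : ∀ z ∈ W, IsIotaHolomorphicAt G z)
    (hH : ∀ z ∈ W, IsIotaHolomorphicAt H z) {r : ℝ} (hr : (r : ℂ) ∈ W)
    (h : ∀ t : ℝ, (t : ℂ) ∈ W → G t = H t) : Set.EqOn G H W := by
  have hlim : Tendsto (fun t : ℝ => (t : ℂ)) (𝓝[≠] r) (𝓝[≠] (r : ℂ)) :=
    tendsto_nhdsWithin_of_tendsto_nhds_of_eventually_within _
      (Complex.continuous_ofReal.continuousAt.tendsto.mono_left nhdsWithin_le_nhds)
      (by filter_upwards [self_mem_nhdsWithin] with t ht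
          simpa using ht)
  have hmem : ∀ᶠ t : ℝ in 𝓝[≠] r, (t : ℂ) ∈ W :=
    (Complex.continuous_ofReal.continuousAt.eventually (hW.mem_nhds hr)).filter_mono
      nhdsWithin_le_nhds
  have hfreq : ∃ᶠ z in 𝓝[≠] (r : ℂ), (toComplexCoords ∘ G) z = (toComplexCoords ∘ H) z :=
    hlim.frequently ((hmem.mono fun t ht => by simp [h t ht]).frequently)
  intro z hz
  exact toComplexCoords.injective <|
    (analyticOnNhd_toComplexCoords hW hG).eqOn_of_preconnected_of_frequently_eq
      (analyticOnNhd_toComplexCoords hW hH) hc hr hfreq hz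

/-! ### The stem functions attached to two slices -/

lemma mem_stemDomain_iff {Ω : Set ℍ} {J : ℍ} {z : ℂ} :
    z ∈ stemDomain Ω J ↔ phi J (fold z) ∈ Ω := by
  constructor
  · rintro (⟨h0, h⟩ | ⟨w, ⟨h0, h⟩, rfl⟩)
    · rwa [fold_of_nonneg h0]
    · rwa [fold_conj, fold_of_nonneg h0]
  · intro h
    rcases le_total 0 z.im with h0 | h0
    · left
      exact ⟨h0, by rwa [fold_of_nonneg h0] at h⟩
    · right
      exact ⟨fold z, ⟨fold_im_nonneg z, h⟩, by rw [fold_of_nonpos h0]; simp⟩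

lemma mem_stemDomain₂_iff {Ω : Set ℍ} {J K : ℍ} {z : ℂ} :
    z ∈ stemDomain₂ Ω J K ↔ z ∈ stemDomain Ω J ∧ z ∈ stemDomain Ω K := by
  rw [mem_stemDomain_iff, mem_stemDomain_iff]
  constructor
  · rintro (⟨⟨h0, h⟩, _, h'⟩ | ⟨w, ⟨⟨h0, h⟩, _, h'⟩, rfl⟩)
    · rw [fold_of_nonneg h0]
      exact ⟨h, h'⟩
    · rw [fold_conj, fold_of_nonneg h0]
      exact ⟨h, h'⟩
  · rintro ⟨h, h'⟩
    rcases le_total 0 z.im with h0 | h0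
    · left
      rw [fold_of_nonneg h0] at h h'
      exact ⟨⟨h0, h⟩, h0, h'⟩
    · right
      exact ⟨fold z, ⟨⟨fold_im_nonneg z, h⟩, fold_im_nonneg z, h'⟩, by
        rw [fold_of_nonpos h0]; simp⟩

lemma isOpen_stemDomain {Ω : Set ℍ} (hΩ : IsOpen Ω) (J : ℍ) : IsOpen (stemDomain Ω J) := by
  have : stemDomain Ω J = (fun z => phi J (fold z)) ⁻¹' Ω := by
    ext z
    exact mem_stemDomain_iff
  rw [this]
  exact hΩ.preimage ((continuous_phi J).comp continuous_fold)

lemma conj_mem_stemDomain {Ω : Set ℍ} {J : ℍ} {z : ℂ} (hz : z ∈ stemDomain Ω J) :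
    (starRingEnd ℂ) z ∈ stemDomain Ω J := by
  rw [mem_stemDomain_iff] at hz ⊢
  rwa [fold_conj]

lemma mem_of_ofReal_mem_stemDomain {Ω : Set ℍ} {J : ℍ} {r : ℝ}
    (h : (r : ℂ) ∈ stemDomain Ω J) : (r : ℍ) ∈ Ω := by
  rwa [mem_stemDomain_iff, fold_ofReal, phi_ofReal] at h

lemma upperStem₂_ofReal (f : ℍ → ℍ) {J K : ℍ} (hJK : J ≠ K) (r : ℝ) :
    upperStem₂ f J K r = (f r, 0) := by
  have h : J - K ≠ 0 := sub_ne_zero.2 hJK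
  simp only [upperStem₂, phi_ofReal, sub_self, mul_zero]
  rw [← sub_mul, ← mul_assoc, inv_mul_cancel₀ h, one_mul]

/-- The stem function of two slices reproduces `f` on the first of them. -/
lemma phiC_upperStem₂ (f : ℍ → ℍ) {J K : ℍ} (hJ : J ∈ imaginaryUnits) (hK : K ∈ imaginaryUnits)
    (hJK : J ≠ K) (z : ℂ) : phiC J (upperStem₂ f J K z) = f (phi J z) := by
  have h : J - K ≠ 0 := sub_ne_zero.2 hJK
  have hcomm : J * (J - K)⁻¹ = -((J - K)⁻¹ * K) := by
    have e : (J - K) * J = -(K * (J - K)) := by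
      rw [sub_mul, mul_sub, mul_self_of_mem hJ, mul_self_of_mem hK]
      abel
    calc J * (J - K)⁻¹ = (J - K)⁻¹ * ((J - K) * J) * (J - K)⁻¹ := by
          rw [← mul_assoc, inv_mul_cancel₀ h, one_mul]
      _ = -((J - K)⁻¹ * K * ((J - K) * (J - K)⁻¹)) := by
          rw [e]
          simp only [mul_neg, neg_mul, mul_assoc]
      _ = -((J - K)⁻¹ * K) := by rw [mul_inv_cancel₀ h, mul_one]
  generalize hp : f (phi J z) = p
  simp only [phiC, upperStem₂, hp]
  rw [← mul_assoc, hcomm, neg_mul, mul_assoc, ← mul_neg, ← mul_add]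
  have : J * p - K * f (phi K z) + -(K * (p - f (phi K z))) = (J - K) * p := by
    rw [mul_sub, sub_mul]
    abel
  rw [this, ← mul_assoc, inv_mul_cancel₀ h, one_mul]

/-- The Cauchy–Riemann equation of a slice regular function, solved for the derivative in the
direction of the imaginary axis. -/
lemma IsSliceRegularOn.hasFDerivAt {f : ℍ → ℍ} {U : Set ℍ} (hf : IsSliceRegularOn f U) {J : ℍ}
    (hJ : J ∈ imaginaryUnits) {z : ℂ} (hz : phi J z ∈ U) :
    ∃ A : ℂ →L[ℝ] ℍ, HasFDerivAt (fun w => f (phi J w)) A z ∧ A Complex.I = J * A 1 := by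
  have ho : IsOpen (phi J ⁻¹' U) := hf.isOpen.preimage (continuous_phi J)
  have hd : DifferentiableAt ℝ (f ∘ phi J) z :=
    ((hf.contDiffOn J hJ).differentiableOn one_ne_zero).differentiableAt (ho.mem_nhds hz)
  refine ⟨fderiv ℝ (f ∘ phi J) z, hd.hasFDerivAt, ?_⟩
  have h := hf.dbar_eq_zero J hJ z hz
  rw [dbar, smul_eq_zero_iff_right (by norm_num)] at h
  rw [eq_neg_of_add_eq_zero_left h, mul_neg, ← mul_assoc, mul_self_of_mem hJ, neg_mul, one_mul,
    neg_neg]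

lemma isIotaHolomorphicAt_upperStem₂ {f : ℍ → ℍ} {U : Set ℍ} (hf : IsSliceRegularOn f U)
    {J K : ℍ} (hJ : J ∈ imaginaryUnits) (hK : K ∈ imaginaryUnits) {z : ℂ} (hz : phi J z ∈ U)
    (hz' : phi K z ∈ U) : IsIotaHolomorphicAt (upperStem₂ f J K) z := by
  obtain ⟨A, hA, hA'⟩ := hf.hasFDerivAt hJ hz
  obtain ⟨B, hB, hB'⟩ := hf.hasFDerivAt hK hz'
  refine .of_hasFDerivAt ((((hA.const_mul J).sub (hB.const_mul K)).const_mul (J - K)⁻¹).prodMk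
    ((hA.sub hB).const_mul (J - K)⁻¹)) ?_
  simp only [ContinuousLinearMap.prod_apply, smul_apply,
    sub_apply, smul_eq_mul, hA', hB', iotaMul, ← mul_assoc J J,
    ← mul_assoc K K, mul_self_of_mem hJ, mul_self_of_mem hK]
  refine Prod.ext ?_ rfl
  simp only [neg_mul, one_mul, ← mul_neg]
  congr 1
  abel

lemma stem₂_of_nonneg (f : ℍ → ℍ) (J K : ℍ) {z : ℂ} (hz : 0 ≤ z.im) :
    stem₂ f J K z = upperStem₂ f J K z := if_pos hz

lemma stem₂_ofReal (f : ℍ → ℍ) {J K : ℍ} (hJK : J ≠ K) (r : ℝ) :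
    stem₂ f J K r = (f r, 0) := by
  rw [stem₂_of_nonneg f J K (by simp), upperStem₂_ofReal f hJK]

lemma cconj_cconj (w : ComplexifiedQuaternion) : cconj (cconj w) = w := by
  simp [cconj]

lemma stem₂_conj (f : ℍ → ℍ) {J K : ℍ} (hJK : J ≠ K) (z : ℂ) :
    stem₂ f J K ((starRingEnd ℂ) z) = cconj (stem₂ f J K z) := by
  rcases lt_trichotomy z.im 0 with h | h | h
  · rw [stem₂, stem₂, if_pos (by simpa using h.le), if_neg h.not_ge, cconj_cconj]
  · obtain ⟨r, rfl⟩ : ∃ r : ℝ, z = r := ⟨z.re, Complex.ext (by simp) (by simpa using h)⟩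
    rw [Complex.conj_ofReal, stem₂_ofReal f hJK]
    simp [cconj]
  · rw [stem₂, stem₂, if_neg (by simpa using h), if_pos h.le, Complex.conj_conj]

/-- Across the real axis holomorphy comes from the reflection principle: both `upperStem₂ f J K`
and its conjugate reflection are holomorphic there and take the value `(f, 0)` at real points. -/
lemma isIotaHolomorphicAt_stem₂ {f : ℍ → ℍ} {Ω : Set ℍ} (hf : IsSliceRegularOn f Ω)
    {J K : ℍ} (hJ : J ∈ imaginaryUnits) (hK : K ∈ imaginaryUnits) (hJK : J ≠ K) {z : ℂ}
    (hz : z ∈ stemDomain Ω J) (hz' : z ∈ stemDomain Ω K) :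
    IsIotaHolomorphicAt (stem₂ f J K) z := by
  rw [mem_stemDomain_iff] at hz hz'
  rcases lt_trichotomy z.im 0 with h | h | h
  · rw [fold_of_nonpos h.le] at hz hz'
    refine (isIotaHolomorphicAt_upperStem₂ hf hJ hK hz hz').conj.congr ?_
    filter_upwards [(isOpen_lt Complex.continuous_im continuous_const).mem_nhds h] with w hw
    exact if_neg (not_le.2 hw)
  · obtain ⟨r, rfl⟩ : ∃ r : ℝ, z = r := ⟨z.re, Complex.ext (by simp) (by simpa using h)⟩
    rw [fold_ofReal] at hz hz'
    have hnhds : phi J ⁻¹' Ω ∩ phi K ⁻¹' Ω ∈ 𝓝 (r : ℂ) :=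
      ((hf.isOpen.preimage (continuous_phi J)).inter
        (hf.isOpen.preimage (continuous_phi K))).mem_nhds ⟨hz, hz'⟩
    obtain ⟨ε, hε, hball⟩ := Metric.mem_nhds_iff.1 hnhds
    have hconj : ∀ w ∈ Metric.ball (r : ℂ) ε, (starRingEnd ℂ) w ∈ Metric.ball (r : ℂ) ε := by
      intro w hw
      rw [Metric.mem_ball, dist_eq_norm] at hw ⊢
      rw [← Complex.conj_ofReal r, ← map_sub, Complex.norm_conj]
      exact hw
    have hG : ∀ w ∈ Metric.ball (r : ℂ) ε, IsIotaHolomorphicAt (upperStem₂ f J K) w :=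
      fun w hw => isIotaHolomorphicAt_upperStem₂ hf hJ hK (hball hw).1 (hball hw).2
    have hrefl := eqOn_of_eq_on_reals (G := upperStem₂ f J K)
      (H := fun w => cconj (upperStem₂ f J K ((starRingEnd ℂ) w))) Metric.isOpen_ball
      (convex_ball _ _).isPreconnected hG (fun w hw => (hG _ (hconj w hw)).conj)
      (Metric.mem_ball_self hε) (fun t _ => by
        rw [Complex.conj_ofReal, upperStem₂_ofReal f hJK]
        simp [cconj])
    refine (hG r (Metric.mem_ball_self hε)).congr ?_
    filter_upwards [Metric.ball_mem_nhds (r : ℂ) hε] with w hw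
    unfold stem₂
    split_ifs
    · rfl
    · exact (hrefl hw).symm
  · rw [fold_of_nonneg h.le] at hz hz'
    refine (isIotaHolomorphicAt_upperStem₂ hf hJ hK hz hz').congr ?_
    filter_upwards [(isOpen_lt continuous_const Complex.continuous_im).mem_nhds h] with w hw
    exact if_pos (le_of_lt hw)

/-! ### The stem family of a slice regular function on a speared open set -/

/-- In a speared open set, every connected component of `D^J` meets the real axis. -/
lemma exists_real_mem_connectedComponentIn {Ω : Set ℍ} (hΩ : IsSpearedOpen Ω) {J : ℍ}
    (hJ : J ∈ imaginaryUnits) {z : ℂ} (hz : z ∈ stemDomain Ω J) :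
    ∃ r : ℝ, (r : ℂ) ∈ connectedComponentIn (stemDomain Ω J) z := by
  have hz1 := mem_stemDomain_iff.1 hz
  have hzx : phi J (fold z) ∈ halfSlice Ω J := ⟨hz1, fold z, fold_im_nonneg z, rfl⟩
  obtain ⟨r, hr⟩ := hΩ.2 J hJ _ hzx
  refine ⟨r, ?_⟩
  set C := upperCoord '' connectedComponentIn (halfSlice Ω J) (phi J (fold z)) with hC
  have hCpre : IsPreconnected C :=
    isPreconnected_connectedComponentIn.image _ continuous_upperCoord.continuousOn
  have hCsub : C ⊆ stemDomain Ω J := by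
    rintro _ ⟨x, hx, rfl⟩
    obtain ⟨hxΩ, w, hw, rfl⟩ := connectedComponentIn_subset _ _ hx
    rw [mem_stemDomain_iff, upperCoord_phi hJ, fold_of_nonneg hw, fold_of_nonneg hw]
    exact hxΩ
  have hzC : fold z ∈ C :=
    ⟨_, mem_connectedComponentIn hzx, by
      rw [upperCoord_phi hJ, fold_of_nonneg (fold_im_nonneg z)]⟩
  have hrC : (r : ℂ) ∈ C := ⟨_, hr, by rw [← phi_ofReal J, upperCoord_phi hJ, fold_ofReal]⟩
  rcases le_total 0 z.im with h0 | h0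
  · rw [fold_of_nonneg h0] at hzC
    exact hCpre.subset_connectedComponentIn hzC hCsub hrC
  · -- below the real axis, use the mirror image of the connected set found above it
    have hsub : (starRingEnd ℂ) '' C ⊆ stemDomain Ω J := by
      rintro _ ⟨w, hw, rfl⟩
      exact conj_mem_stemDomain (hCsub hw)
    refine (hCpre.image _ Complex.continuous_conj.continuousOn).subset_connectedComponentIn
      ⟨_, hzC, ?_⟩ hsub ⟨_, hrC, Complex.conj_ofReal r⟩
    rw [fold_of_nonpos h0, Complex.conj_conj]

/-- Every point of `D^J` has a connected neighbourhood, reaching the real axis, that is contained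
in `D^{J'}` for all `J'` close to `J`: a neighbourhood of a path to the real axis, by compactness
of the path. -/
lemma exists_tube {Ω : Set ℍ} (hΩ : IsSpearedOpen Ω) {J : ℍ} (hJ : J ∈ imaginaryUnits) {z : ℂ}
    (hz : z ∈ stemDomain Ω J) :
    ∃ ε > 0, ∃ W : Set ℂ, IsOpen W ∧ IsPreconnected W ∧ z ∈ W ∧ (∃ r : ℝ, (r : ℂ) ∈ W) ∧
      ∀ J' : ℍ, ‖J' - J‖ < ε → W ⊆ stemDomain Ω J' := by
  obtain ⟨r, hr⟩ := exists_real_mem_connectedComponentIn hΩ hJ hz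
  have hD := isOpen_stemDomain hΩ.1 J
  have hpath : IsPathConnected (connectedComponentIn (stemDomain Ω J) z) :=
    hD.connectedComponentIn.isConnected_iff_isPathConnected.1
      (isConnected_connectedComponentIn_iff.2 hz)
  obtain ⟨γ, hγ⟩ := hpath.joinedIn z (mem_connectedComponentIn hz) r hr
  have hopen : IsOpen {p : ℂ × ℍ | phi p.2 (fold p.1) ∈ Ω} :=
    hΩ.1.preimage (continuous_phi_uncurried.comp
      ((continuous_fold.comp continuous_fst).prodMk continuous_snd))
  have hsub : Set.range γ ×ˢ {J} ⊆ {p : ℂ × ℍ | phi p.2 (fold p.1) ∈ Ω} := by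
    rintro ⟨_, _⟩ ⟨⟨t, rfl⟩, rfl⟩
    exact mem_stemDomain_iff.1 (connectedComponentIn_subset _ _ (hγ t))
  obtain ⟨U, V, hU, hV, hγU, hJV, hUV⟩ :=
    generalized_tube_lemma (isCompact_range γ.continuous) isCompact_singleton hopen hsub
  obtain ⟨ε, hε, hball⟩ := Metric.isOpen_iff.1 hV J (hJV rfl)
  have hzγ : z ∈ Set.range γ := ⟨0, γ.source⟩
  refine ⟨ε, hε, connectedComponentIn U z, hU.connectedComponentIn,
    isPreconnected_connectedComponentIn, mem_connectedComponentIn (hγU hzγ), ⟨r, ?_⟩, ?_⟩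
  · exact (isPreconnected_range γ.continuous).subset_connectedComponentIn hzγ hγU ⟨1, γ.target⟩
  · intro J' hJ' w hw
    exact mem_stemDomain_iff.2 (hUV (Set.mk_mem_prod (connectedComponentIn_subset _ _ hw)
      (hball (by rwa [Metric.mem_ball, dist_eq_norm]))))

/-- `w` is the common value at `z` of the functions `F^{J',K'}` for all distinct `J'`, `K'` close
enough to `J`. -/
def IsStemValue (f : ℍ → ℍ) (J : ℍ) (z : ℂ) (w : ComplexifiedQuaternion) : Prop :=
  ∃ ε > 0, ∀ J' ∈ imaginaryUnits, ∀ K' ∈ imaginaryUnits, ‖J' - J‖ < ε → ‖K' - J‖ < ε →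
    J' ≠ K' → stem₂ f J' K' z = w

/-- The function `F^J`, with unspecified values off `D^J`. -/
def stemFamily (f : ℍ → ℍ) (J : ℍ) (z : ℂ) : ComplexifiedQuaternion :=
  Classical.epsilon (IsStemValue f J z)

lemma IsStemValue.unique {f : ℍ → ℍ} {J : ℍ} (hJ : J ∈ imaginaryUnits) {z : ℂ}
    {v w : ComplexifiedQuaternion} (hv : IsStemValue f J z v) (hw : IsStemValue f J z w) :
    v = w := by
  obtain ⟨ε, hε, h⟩ := hv
  obtain ⟨δ, hδ, h'⟩ := hw
  obtain ⟨K, hK, hKJ, hlt⟩ := exists_unit_near hJ (lt_min hε hδ)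
  have h0 : ‖J - J‖ = 0 := by simp
  rw [← h J hJ K hK (h0 ▸ hε) (hlt.trans_le (min_le_left _ _)) hKJ.symm,
    ← h' J hJ K hK (h0 ▸ hδ) (hlt.trans_le (min_le_right _ _)) hKJ.symm]

lemma IsStemValue.stemFamily_eq {f : ℍ → ℍ} {J : ℍ} (hJ : J ∈ imaginaryUnits) {z : ℂ}
    {w : ComplexifiedQuaternion} (hw : IsStemValue f J z w) : stemFamily f J z = w :=
  (Classical.epsilon_spec (p := IsStemValue f J z) ⟨w, hw⟩).unique hJ hw

/-- Near a point of `D^J`, all the functions `F^{J',K'}` with `J'`, `K'` close to `J` agree: on a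
tube they are holomorphic, and at real points they take the same value `(f, 0)`. All the functions
`F^L` with `L` close to `J` then agree with them as well. -/
lemma exists_stemFamily_eqOn {f : ℍ → ℍ} {Ω : Set ℍ} (hΩ : IsSpearedOpen Ω)
    (hf : IsSliceRegularOn f Ω) {J : ℍ} (hJ : J ∈ imaginaryUnits) {z : ℂ}
    (hz : z ∈ stemDomain Ω J) :
    ∃ ε > 0, ∃ W : Set ℂ, IsOpen W ∧ z ∈ W ∧ (∀ J' : ℍ, ‖J' - J‖ < ε → W ⊆ stemDomain Ω J') ∧
      ∀ L ∈ imaginaryUnits, ∀ J' ∈ imaginaryUnits, ∀ K' ∈ imaginaryUnits, ‖L - J‖ < ε →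
        ‖J' - J‖ < ε → ‖K' - J‖ < ε → J' ≠ K' → Set.EqOn (stem₂ f J' K') (stemFamily f L) W := by
  obtain ⟨ε, hε, W, hWo, hWc, hzW, ⟨r, hr⟩, hW⟩ := exists_tube hΩ hJ hz
  refine ⟨ε, hε, W, hWo, hzW, hW, ?_⟩
  intro L hL J' hJ' K' hK' hLε hJε hKε hne w hw
  refine (IsStemValue.stemFamily_eq hL ⟨ε - ‖L - J‖, by linarith, ?_⟩).symm
  intro J₁ hJ₁ K₁ hK₁ hJ₁ε hK₁ε hne₁
  have hJ₁ε' : ‖J₁ - J‖ < ε := by linarith [norm_sub_le_norm_sub_add_norm_sub J₁ L J]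
  have hK₁ε' : ‖K₁ - J‖ < ε := by linarith [norm_sub_le_norm_sub_add_norm_sub K₁ L J]
  exact eqOn_of_eq_on_reals hWo hWc
    (fun w hw => isIotaHolomorphicAt_stem₂ hf hJ₁ hK₁ hne₁ (hW _ hJ₁ε' hw) (hW _ hK₁ε' hw))
    (fun w hw => isIotaHolomorphicAt_stem₂ hf hJ' hK' hne (hW _ hJε hw) (hW _ hKε hw)) hr
    (fun t _ => by rw [stem₂_ofReal f hne₁, stem₂_ofReal f hne]) hw

/-- Near a point of `D^J`, the function `F^J` is one of the functions `F^{J,K}`, and it has the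
same germ as `F^L` for all `L` close to `J`. -/
lemma exists_stem₂_eventuallyEq {f : ℍ → ℍ} {Ω : Set ℍ} (hΩ : IsSpearedOpen Ω)
    (hf : IsSliceRegularOn f Ω) {J : ℍ} (hJ : J ∈ imaginaryUnits) {z : ℂ}
    (hz : z ∈ stemDomain Ω J) :
    ∃ ε > 0, ∃ K ∈ imaginaryUnits, J ≠ K ∧ z ∈ stemDomain Ω K ∧
      ∀ L ∈ imaginaryUnits, ‖L - J‖ < ε → stemFamily f L =ᶠ[𝓝 z] stem₂ f J K := by
  obtain ⟨ε, hε, W, hWo, hzW, hW, h⟩ := exists_stemFamily_eqOn hΩ hf hJ hz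
  obtain ⟨K, hK, hKJ, hlt⟩ := exists_unit_near hJ hε
  refine ⟨ε, hε, K, hK, hKJ.symm, hW K hlt hzW, fun L hL hLJ => ?_⟩
  filter_upwards [hWo.mem_nhds hzW] with w hw
  exact (h L hL J hJ K hK hLJ (by simpa using hε) hlt hKJ.symm hw).symm

lemma isIotaHolomorphicAt_stemFamily {f : ℍ → ℍ} {Ω : Set ℍ} (hΩ : IsSpearedOpen Ω)
    (hf : IsSliceRegularOn f Ω) {J : ℍ} (hJ : J ∈ imaginaryUnits) {z : ℂ}
    (hz : z ∈ stemDomain Ω J) : IsIotaHolomorphicAt (stemFamily f J) z := by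
  obtain ⟨ε, hε, K, hK, hJK, hzK, h⟩ := exists_stem₂_eventuallyEq hΩ hf hJ hz
  exact (isIotaHolomorphicAt_stem₂ hf hJ hK hJK hz hzK).congr (h J hJ (by simpa using hε))

lemma stemFamily_ofReal {f : ℍ → ℍ} {Ω : Set ℍ} (hΩ : IsSpearedOpen Ω)
    (hf : IsSliceRegularOn f Ω) {J : ℍ} (hJ : J ∈ imaginaryUnits) {r : ℝ}
    (hr : (r : ℂ) ∈ stemDomain Ω J) : stemFamily f J r = (f r, 0) := by
  obtain ⟨ε, hε, K, -, hJK, -, h⟩ := exists_stem₂_eventuallyEq hΩ hf hJ hr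
  rw [(h J hJ (by simpa using hε)).eq_of_nhds, stem₂_ofReal f hJK]

lemma phiC_stemFamily {f : ℍ → ℍ} {Ω : Set ℍ} (hΩ : IsSpearedOpen Ω)
    (hf : IsSliceRegularOn f Ω) {J : ℍ} (hJ : J ∈ imaginaryUnits) {z : ℂ} (hz0 : 0 ≤ z.im)
    (hz : phi J z ∈ Ω) : phiC J (stemFamily f J z) = f (phi J z) := by
  have hzD : z ∈ stemDomain Ω J := by rwa [mem_stemDomain_iff, fold_of_nonneg hz0]
  obtain ⟨ε, hε, K, hK, hJK, -, h⟩ := exists_stem₂_eventuallyEq hΩ hf hJ hzD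
  rw [(h J hJ (by simpa using hε)).eq_of_nhds, stem₂_of_nonneg f J K hz0,
    phiC_upperStem₂ f hJ hK hJK]

lemma stemFamily_conj {f : ℍ → ℍ} {Ω : Set ℍ} (hΩ : IsSpearedOpen Ω)
    (hf : IsSliceRegularOn f Ω) {J : ℍ} (hJ : J ∈ imaginaryUnits) {z : ℂ}
    (hz : z ∈ stemDomain Ω J) :
    stemFamily f J ((starRingEnd ℂ) z) = cconj (stemFamily f J z) := by
  obtain ⟨ε, hε, W, -, hzW, -, h⟩ := exists_stemFamily_eqOn hΩ hf hJ hz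
  refine IsStemValue.stemFamily_eq hJ ⟨ε, hε, ?_⟩
  intro J' hJ' K' hK' hJε hKε hne
  rw [stem₂_conj f hne, h J hJ J' hJ' K' hK' (by simpa using hε) hJε hKε hne hzW]

lemma exists_ofReal_mem {Ω : Set ℍ} (hΩ : IsSpearedDomain Ω) : ∃ r : ℝ, (r : ℍ) ∈ Ω := by
  obtain ⟨x, hx⟩ := hΩ.1.2.nonempty
  have hx' : upperCoord x ∈ stemDomain Ω (unitOf x) := by
    rwa [mem_stemDomain_iff, fold_of_nonneg (upperCoord_im_nonneg x), phi_unitOf_upperCoord]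
  obtain ⟨r, hr⟩ := exists_real_mem_connectedComponentIn hΩ.2 (unitOf_mem x) hx'
  exact ⟨r, mem_of_ofReal_mem_stemDomain (connectedComponentIn_subset _ _ hr)⟩

lemma isHolomorphicStemOn_stemFamily {f : ℍ → ℍ} {Ω : Set ℍ} (hΩ : IsSpearedDomain Ω)
    (hf : IsSliceRegularOn f Ω) {J : ℍ} (hJ : J ∈ imaginaryUnits) :
    IsHolomorphicStemOn (stemFamily f J) (stemDomain Ω J) where
  isOpen := isOpen_stemDomain hf.isOpen J
  nonempty := by
    obtain ⟨r, hr⟩ := exists_ofReal_mem hΩ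
    exact ⟨r, by rwa [mem_stemDomain_iff, fold_ofReal, phi_ofReal]⟩
  conj_mem _ := conj_mem_stemDomain
  map_conj _ := stemFamily_conj hΩ.2 hf hJ
  contDiffOn := contDiffOn_of_isIotaHolomorphicAt (isOpen_stemDomain hf.isOpen J)
    fun _ hz => isIotaHolomorphicAt_stemFamily hΩ.2 hf hJ hz
  cauchyRiemann _ hz := (isIotaHolomorphicAt_stemFamily hΩ.2 hf hJ hz).2

lemma isHolomorphicStemFamily_stemFamily {f : ℍ → ℍ} {Ω : Set ℍ} (hΩ : IsSpearedDomain Ω)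
    (hf : IsSliceRegularOn f Ω) : IsHolomorphicStemFamily Ω f (stemFamily f) where
  stem _ := isHolomorphicStemOn_stemFamily hΩ hf
  spec J hJ z hz := by
    obtain ⟨ε, hε, W, hWo, hzW, hW, h⟩ := exists_stemFamily_eqOn hΩ.2 hf hJ hz
    have h0 : ‖J - J‖ < ε := by simpa using hε
    refine ⟨ε, hε, W, hWo, hzW, hW J h0, fun J' hJ' K' hK' hJε hKε hne => ⟨?_, ?_⟩⟩
    · exact fun w hw => mem_stemDomain₂_iff.2 ⟨hW J' hJε hw, hW K' hKε hw⟩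
    · exact h J hJ J' hJ' K' hK' h0 hJε hKε hne

/-! ### Propagation of the stem germs along chains -/

/-- The points `x` and `y` lie on a same sphere and the members of the stem family belonging to
their half-slices have the same germ at the corresponding point of the upper half-plane. -/
def SameStemGerm (f : ℍ → ℍ) (x y : ℍ) : Prop :=
  upperCoord x = upperCoord y ∧
    stemFamily f (unitOf x) =ᶠ[𝓝 (upperCoord x)] stemFamily f (unitOf y)

lemma SameStemGerm.refl (f : ℍ → ℍ) (x : ℍ) : SameStemGerm f x x := ⟨rfl, .rfl⟩

lemma SameStemGerm.symm {f : ℍ → ℍ} {x y : ℍ} (h : SameStemGerm f x y) : SameStemGerm f y x :=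
  ⟨h.1.symm, h.1 ▸ h.2.symm⟩

lemma SameStemGerm.trans {f : ℍ → ℍ} {x y z : ℍ} (h : SameStemGerm f x y)
    (h' : SameStemGerm f y z) : SameStemGerm f x z :=
  ⟨h.1.trans h'.1, h.2.trans (h.1 ▸ h'.2)⟩

/-- At a real point of `Ω` all members of the stem family have the same germ. -/
lemma stemFamily_eventuallyEq_of_real {f : ℍ → ℍ} {Ω : Set ℍ} (hΩ : IsSpearedOpen Ω)
    (hf : IsSliceRegularOn f Ω) {J K : ℍ} (hJ : J ∈ imaginaryUnits) (hK : K ∈ imaginaryUnits)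
    {r : ℝ} (hr : (r : ℍ) ∈ Ω) : stemFamily f J =ᶠ[𝓝 (r : ℂ)] stemFamily f K := by
  have hmem : ∀ L : ℍ, (r : ℂ) ∈ stemDomain Ω L := fun L => by
    rwa [mem_stemDomain_iff, fold_ofReal, phi_ofReal]
  obtain ⟨ε, hε, hball⟩ := Metric.mem_nhds_iff.1 (((isOpen_stemDomain hf.isOpen J).inter
    (isOpen_stemDomain hf.isOpen K)).mem_nhds ⟨hmem J, hmem K⟩)
  filter_upwards [Metric.ball_mem_nhds (r : ℂ) hε] with w hw
  exact eqOn_of_eq_on_reals Metric.isOpen_ball (convex_ball _ _).isPreconnected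
    (fun z hz => isIotaHolomorphicAt_stemFamily hΩ hf hJ (hball hz).1)
    (fun z hz => isIotaHolomorphicAt_stemFamily hΩ hf hK (hball hz).2) (Metric.mem_ball_self hε)
    (fun t ht => by
      rw [stemFamily_ofReal hΩ hf hJ (hball ht).1, stemFamily_ofReal hΩ hf hK (hball ht).2]) hw

/-- The germ attached to a point does not depend on the half-slice through it. -/
lemma stemFamily_unitOf_phi {f : ℍ → ℍ} {Ω : Set ℍ} (hΩ : IsSpearedOpen Ω)
    (hf : IsSliceRegularOn f Ω) {J : ℍ} (hJ : J ∈ imaginaryUnits) {z : ℂ} (hz0 : 0 ≤ z.im)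
    (hz : phi J z ∈ Ω) : stemFamily f (unitOf (phi J z)) =ᶠ[𝓝 z] stemFamily f J := by
  rcases hz0.eq_or_lt' with h | h
  · obtain ⟨r, rfl⟩ : ∃ r : ℝ, z = r := ⟨z.re, Complex.ext (by simp) (by simpa using h)⟩
    rw [phi_ofReal] at hz
    exact stemFamily_eventuallyEq_of_real hΩ hf (unitOf_mem _) hJ hz
  · rw [unitOf_phi hJ h]

lemma sameStemGerm_phi_iff {f : ℍ → ℍ} {Ω : Set ℍ} (hΩ : IsSpearedOpen Ω)
    (hf : IsSliceRegularOn f Ω) {J K : ℍ} (hJ : J ∈ imaginaryUnits) (hK : K ∈ imaginaryUnits)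
    {z : ℂ} (hz0 : 0 ≤ z.im) (hJz : phi J z ∈ Ω) (hKz : phi K z ∈ Ω) :
    SameStemGerm f (phi J z) (phi K z) ↔ stemFamily f J =ᶠ[𝓝 z] stemFamily f K := by
  have h1 := stemFamily_unitOf_phi hΩ hf hJ hz0 hJz
  have h2 := stemFamily_unitOf_phi hΩ hf hK hz0 hKz
  rw [SameStemGerm, upperCoord_phi hJ, upperCoord_phi hK, fold_of_nonneg hz0]
  exact ⟨fun h => h1.symm.trans (h.2.trans h2), fun h => ⟨rfl, h1.trans (h.trans h2.symm)⟩⟩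

/-- Equality of germs is transported by shadowing: the path involved lies in the common domain of
two members of the stem family, where the identity principle applies. -/
lemma Shadows.sameStemGerm_iff {f : ℍ → ℍ} {Ω : Set ℍ} (hΩ : IsSpearedOpen Ω)
    (hf : IsSliceRegularOn f Ω) {x₀ x₁ y₀ y₁ : ℍ} (h : Shadows Ω x₁ y₁ x₀ y₀) :
    SameStemGerm f x₀ x₁ ↔ SameStemGerm f y₀ y₁ := by
  obtain ⟨J₀, hJ₀, J₁, hJ₁, z, w, rfl, rfl, rfl, rfl, γ, hγ⟩ := h
  have hz := hγ 0
  have hw := hγ 1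
  rw [γ.source] at hz
  rw [γ.target] at hw
  rw [sameStemGerm_phi_iff hΩ hf hJ₀ hJ₁ hz.1.1 hz.1.2 hz.2.2,
    sameStemGerm_phi_iff hΩ hf hJ₀ hJ₁ hw.1.1 hw.1.2 hw.2.2]
  set D := stemDomain Ω J₀ ∩ stemDomain Ω J₁
  have hD : IsOpen D := (isOpen_stemDomain hf.isOpen J₀).inter (isOpen_stemDomain hf.isOpen J₁)
  have hsub : Set.range γ ⊆ D := by
    rintro _ ⟨t, rfl⟩
    exact ⟨Or.inl (hγ t).1, Or.inl (hγ t).2⟩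
  have hzγ : z ∈ Set.range γ := ⟨0, γ.source⟩
  have hwC : w ∈ connectedComponentIn D z :=
    (isPreconnected_range γ.continuous).subset_connectedComponentIn hzγ hsub ⟨1, γ.target⟩
  have hzC : z ∈ connectedComponentIn D z := mem_connectedComponentIn (hsub hzγ)
  have hC : IsOpen (connectedComponentIn D z) := hD.connectedComponentIn
  have key : ∀ u ∈ connectedComponentIn D z, ∀ v ∈ connectedComponentIn D z,
      stemFamily f J₀ =ᶠ[𝓝 u] stemFamily f J₁ → stemFamily f J₀ =ᶠ[𝓝 v] stemFamily f J₁ := by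
    intro u hu v hv h
    have := eqOn_of_eventuallyEq hC isPreconnected_connectedComponentIn
      (fun p hp => isIotaHolomorphicAt_stemFamily hΩ hf hJ₀ (connectedComponentIn_subset _ _ hp).1)
      (fun p hp => isIotaHolomorphicAt_stemFamily hΩ hf hJ₁ (connectedComponentIn_subset _ _ hp).2)
      hu h
    filter_upwards [hC.mem_nhds hv] with p hp using this hp
  exact ⟨key z hzC w hwC, key w hwC z hzC⟩

/-- Points of `Ω` that are close to each other on a same sphere have the same stem germ. -/
lemma eventually_sameStemGerm {f : ℍ → ℍ} {Ω : Set ℍ} (hΩ : IsSpearedOpen Ω)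
    (hf : IsSliceRegularOn f Ω) {y : ℍ} (hy : y ∈ Ω) :
    ∀ᶠ y' in 𝓝 y, upperCoord y' = upperCoord y → SameStemGerm f y y' := by
  have hyD : upperCoord y ∈ stemDomain Ω (unitOf y) := by
    rwa [mem_stemDomain_iff, fold_of_nonneg (upperCoord_im_nonneg y), phi_unitOf_upperCoord]
  obtain ⟨ε, hε, K, -, -, -, h⟩ := exists_stem₂_eventuallyEq hΩ hf (unitOf_mem y) hyD
  rcases (upperCoord_im_nonneg y).eq_or_lt' with h0 | h0
  · -- the sphere through a real point reduces to that point
    refine Eventually.of_forall fun y' hy' => ?_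
    have e : ∀ J : ℍ, phi J (upperCoord y) = ((upperCoord y).re : ℍ) := fun J => by
      simp [phi, h0]
    have : y' = y := by
      rw [← phi_unitOf_upperCoord y', hy', e, ← e (unitOf y), phi_unitOf_upperCoord]
    rw [this]
    exact .refl f y
  · filter_upwards [Metric.ball_mem_nhds y (mul_pos h0 hε)] with y' hy' heq
    refine ⟨heq.symm, (h _ (unitOf_mem y) (by simpa using hε)).trans
      (h _ (unitOf_mem y') ?_).symm⟩
    have hdiff : y' - y = (upperCoord y).im • (unitOf y' - unitOf y) := by
      conv_lhs => rw [← phi_unitOf_upperCoord y', ← phi_unitOf_upperCoord y, heq]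
      rw [phi, phi, add_sub_add_left_eq_sub, ← mul_sub, Quaternion.coe_mul_eq_smul]
    rw [Metric.mem_ball, dist_eq_norm, hdiff, norm_smul, Real.norm_of_nonneg h0.le] at hy'
    exact lt_of_mul_lt_mul_left hy' h0.le

lemma SimpleStep.sameStemGerm {f : ℍ → ℍ} {Ω : Set ℍ} (hΩ : IsSpearedOpen Ω)
    (hf : IsSliceRegularOn f Ω) {x : ℕ → ℍ} {s : ℕ} (hx : x s ∈ Ω) (h : SimpleStep Ω x s) :
    SameStemGerm f (x s) (x (s + 1)) := by
  rcases h with h | ⟨r, hr, h⟩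
  · have hxs : x s ∈ sphereThrough (x s) ∩ Ω := ⟨mem_sphereThrough_iff.2 rfl, hx⟩
    refine isPreconnected_connectedComponentIn.induction₂ (SameStemGerm f) ?_
      (fun _ _ _ _ _ _ => SameStemGerm.trans) (fun _ _ _ _ => SameStemGerm.symm)
      (mem_connectedComponentIn hxs) h
    intro y hy
    obtain ⟨hyS, hyΩ⟩ := connectedComponentIn_subset _ _ hy
    filter_upwards [(eventually_sameStemGerm hΩ hf hyΩ).filter_mono nhdsWithin_le_nhds,
      self_mem_nhdsWithin] with y' hy' hy'C
    exact hy' ((mem_sphereThrough_iff.1 (connectedComponentIn_subset _ _ hy'C).1).trans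
      (mem_sphereThrough_iff.1 hyS).symm)
  · exact (h.sameStemGerm_iff hΩ hf).2 (.refl f _)

/-- The stem germs at the two ends of a chain agree. The double steps are nested like brackets, so
by induction the two inner points of a double step have the same germ, and shadowing transports
this equality to its outer points. -/
lemma IsHingeChain.sameStemGerm {f : ℍ → ℍ} {Ω : Set ℍ} (hΩ : IsSpearedOpen Ω)
    (hf : IsSliceRegularOn f Ω) {t : ℕ} {x : ℕ → ℍ} (h : IsHingeChain Ω t x) :
    SameStemGerm f (x 0) (x t) := by
  obtain ⟨-, hxΩ, l, a, b, hinj, hrange, hdouble, hmono, hnest⟩ := h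
  have hab : ∀ m n, a m ≠ b n := fun m n e => Sum.inl_ne_inr (@hinj (.inl m) (.inr n) e)
  have hb : ∀ {m n}, b m = b n → m = n := fun {m n} e =>
    Sum.inr_injective (@hinj (.inr m) (.inr n) e)
  have hnot : ∀ s < t, ¬ SimpleStep Ω x s → (∃ m, s = a m) ∨ ∃ m, s = b m := by
    intro s hs hns
    have : s ∈ Set.range (Sum.elim a b) := hrange ▸ ⟨hs, hns⟩
    obtain ⟨m | m, rfl⟩ := this
    · exact .inl ⟨m, rfl⟩
    · exact .inr ⟨m, rfl⟩
  -- intervals containing either both indices of a double step or none of them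
  have key : ∀ n p q, q = p + n → q ≤ t →
      (∀ m, (p ≤ a m ∧ a m < q) ↔ (p ≤ b m ∧ b m < q)) → SameStemGerm f (x p) (x q) := by
    intro n
    induction n using Nat.strong_induction_on with
    | _ n ih =>
      intro p q hq hqt hbal
      rcases n.eq_zero_or_pos with rfl | hn
      · rw [hq]
        exact .refl f _
      by_cases hp : SimpleStep Ω x p
      · refine (hp.sameStemGerm hΩ hf (hxΩ p (by omega))).trans
          (ih (n - 1) (by omega) (p + 1) q (by omega) hqt fun m => ?_)
        have hnonsimple : ∀ s, s ∈ Set.range (Sum.elim a b) → s ≠ p := by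
          rintro s hs rfl
          rw [hrange] at hs
          exact hs.2 hp
        have h1 := hnonsimple (a m) ⟨.inl m, rfl⟩
        have h2 := hnonsimple (b m) ⟨.inr m, rfl⟩
        have h3 := hbal m
        omega
      · rcases hnot p (by omega) hp with ⟨m, rfl⟩ | ⟨m, rfl⟩
        · obtain ⟨hlt, hbt, -, hsh⟩ := hdouble m
          have hbm := ((hbal m).1 ⟨le_rfl, by omega⟩).2
          -- every other double step is contained in one of the intervals cut out by this one
          have hother : ∀ k, k ≠ m → a m ≤ a k → a m < a k ∧ (b m < a k ∨ b k < b m) := by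
            intro k hk hle
            have hlt : m < k := lt_of_le_of_ne (hmono.le_iff_le.1 hle) hk.symm
            exact ⟨hmono hlt, hnest m k hlt⟩
          have hinner := ih (b m - (a m + 1)) (by omega) (a m + 1) (b m) (by omega) (by omega)
            fun k => by
              by_cases hk : k = m
              · subst hk
                omega
              have h1 := hother k hk
              have h2 := hbal k
              have h3 := (hdouble k).1
              omega
          have houter := ih (q - (b m + 1)) (by omega) (b m + 1) q (by omega) hqt
            fun k => by
              by_cases hk : k = m
              · subst hk
                omega
              have h1 := hother k hk
              have h2 := hbal k
              have h3 := (hdouble k).1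
              have h4 : b k ≠ b m := fun e => hk (hb e)
              have h5 := hab k m
              omega
          exact ((hsh.sameStemGerm_iff hΩ hf).2 hinner).trans houter
        · have h1 := (hbal m).2 ⟨le_rfl, by omega⟩
          have h2 := (hdouble m).1
          omega
  refine key t 0 t (by omega) le_rfl fun m => ?_
  have := hdouble m
  have h1 := this.1
  have h2 := this.2.1
  omega

/-! ### Gluing the stem family and extending the function -/

lemma stemFamily_eq_of_hinged {f : ℍ → ℍ} {Ω : Set ℍ} (hΩ : IsHingedDomain Ω)
    (hf : IsSliceRegularOn f Ω) {J K : ℍ} (hJ : J ∈ imaginaryUnits) (hK : K ∈ imaginaryUnits)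
    {z : ℂ} (hzJ : z ∈ stemDomain Ω J) (hzK : z ∈ stemDomain Ω K) :
    stemFamily f J z = stemFamily f K z := by
  have hJz := mem_stemDomain_iff.1 hzJ
  have hKz := mem_stemDomain_iff.1 hzK
  have hfold : stemFamily f J (fold z) = stemFamily f K (fold z) := by
    obtain ⟨t, c, hc, h0, ht⟩ := hΩ.2 _ hJz (phi K (fold z))
      ⟨mem_sphereThrough_iff.2 (by rw [upperCoord_phi hJ, upperCoord_phi hK]), hKz⟩
    have h := hc.sameStemGerm hΩ.1.2 hf
    rw [h0, ht, sameStemGerm_phi_iff hΩ.1.2 hf hJ hK (fold_im_nonneg z) hJz hKz] at h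
    exact h.eq_of_nhds
  rcases le_total 0 z.im with h | h
  · rwa [fold_of_nonneg h] at hfold
  · rw [fold_of_nonpos h, stemFamily_conj hΩ.1.2 hf hJ hzJ, stemFamily_conj hΩ.1.2 hf hK hzK]
      at hfold
    rw [← cconj_cconj (stemFamily f J z), hfold, cconj_cconj]

/-- The union of the domains of the stem family. -/
def totalStemDomain (Ω : Set ℍ) : Set ℂ := ⋃ J ∈ imaginaryUnits, stemDomain Ω J

lemma mem_totalStemDomain_iff {Ω : Set ℍ} {z : ℂ} :
    z ∈ totalStemDomain Ω ↔ ∃ J ∈ imaginaryUnits, z ∈ stemDomain Ω J := by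
  simp [totalStemDomain]

lemma fold_mem_totalStemDomain_iff {Ω : Set ℍ} {z : ℂ} :
    fold z ∈ totalStemDomain Ω ↔ z ∈ totalStemDomain Ω := by
  simp only [mem_totalStemDomain_iff, mem_stemDomain_iff, fold_of_nonneg (fold_im_nonneg z)]

lemma mem_symmetricCompletion_iff {Ω : Set ℍ} {x : ℍ} :
    x ∈ symmetricCompletion Ω ↔ upperCoord x ∈ totalStemDomain Ω := by
  simp only [symmetricCompletion, Set.mem_iUnion₂, mem_sphereThrough_iff, exists_prop,
    mem_totalStemDomain_iff, mem_stemDomain_iff, fold_of_nonneg (upperCoord_im_nonneg x)]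
  constructor
  · rintro ⟨y, hy, hxy⟩
    exact ⟨unitOf y, unitOf_mem y, by rwa [hxy, phi_unitOf_upperCoord]⟩
  · rintro ⟨J, hJ, h⟩
    exact ⟨_, h, by rw [upperCoord_phi hJ, fold_of_nonneg (upperCoord_im_nonneg x)]⟩

lemma phi_mem_symmetricCompletion_iff {Ω : Set ℍ} {J : ℍ} (hJ : J ∈ imaginaryUnits) {z : ℂ} :
    phi J z ∈ symmetricCompletion Ω ↔ z ∈ totalStemDomain Ω := by
  rw [mem_symmetricCompletion_iff, upperCoord_phi hJ, fold_mem_totalStemDomain_iff]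

lemma isOpen_totalStemDomain {Ω : Set ℍ} (hΩ : IsOpen Ω) : IsOpen (totalStemDomain Ω) :=
  isOpen_biUnion fun J _ => isOpen_stemDomain hΩ J

lemma isOpen_symmetricCompletion {Ω : Set ℍ} (hΩ : IsOpen Ω) :
    IsOpen (symmetricCompletion Ω) := by
  have : symmetricCompletion Ω = upperCoord ⁻¹' totalStemDomain Ω := by
    ext x
    exact mem_symmetricCompletion_iff
  rw [this]
  exact (isOpen_totalStemDomain hΩ).preimage continuous_upperCoord

lemma circularization_totalStemDomain (Ω : Set ℍ) :
    circularization (totalStemDomain Ω) = symmetricCompletion Ω := by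
  ext x
  constructor
  · rintro ⟨z, hz, I, hI, rfl⟩
    exact (phi_mem_symmetricCompletion_iff hI).2 hz
  · intro hx
    exact ⟨upperCoord x, mem_symmetricCompletion_iff.1 hx, unitOf x, unitOf_mem x,
      (phi_unitOf_upperCoord x).symm⟩

open Classical in
/-- The function on the union of the domains `D^J` that takes at each point the value of some
member of the stem family defined there. -/
def gluedStem (Ω : Set ℍ) (f : ℍ → ℍ) (z : ℂ) : ComplexifiedQuaternion :=
  if h : ∃ J ∈ imaginaryUnits, z ∈ stemDomain Ω J then stemFamily f h.choose z else 0

lemma gluedStem_eqOn {f : ℍ → ℍ} {Ω : Set ℍ} (hΩ : IsHingedDomain Ω)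
    (hf : IsSliceRegularOn f Ω) {J : ℍ} (hJ : J ∈ imaginaryUnits) :
    Set.EqOn (gluedStem Ω f) (stemFamily f J) (stemDomain Ω J) := by
  intro z hz
  have h : ∃ J ∈ imaginaryUnits, z ∈ stemDomain Ω J := ⟨J, hJ, hz⟩
  rw [gluedStem, dif_pos h]
  exact stemFamily_eq_of_hinged hΩ hf h.choose_spec.1 hJ h.choose_spec.2 hz

lemma isIotaHolomorphicAt_gluedStem {f : ℍ → ℍ} {Ω : Set ℍ} (hΩ : IsHingedDomain Ω)
    (hf : IsSliceRegularOn f Ω) {z : ℂ} (hz : z ∈ totalStemDomain Ω) :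
    IsIotaHolomorphicAt (gluedStem Ω f) z := by
  obtain ⟨J, hJ, hzJ⟩ := mem_totalStemDomain_iff.1 hz
  refine (isIotaHolomorphicAt_stemFamily hΩ.1.2 hf hJ hzJ).congr ?_
  filter_upwards [(isOpen_stemDomain hf.isOpen J).mem_nhds hzJ] with w hw
    using gluedStem_eqOn hΩ hf hJ hw

lemma isHolomorphicStemOn_gluedStem {f : ℍ → ℍ} {Ω : Set ℍ} (hΩ : IsHingedDomain Ω)
    (hf : IsSliceRegularOn f Ω) :
    IsHolomorphicStemOn (gluedStem Ω f) (totalStemDomain Ω) where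
  isOpen := isOpen_totalStemDomain hf.isOpen
  nonempty := by
    obtain ⟨x, hx⟩ := hΩ.1.1.2.nonempty
    exact ⟨upperCoord x, mem_symmetricCompletion_iff.1
      (Set.mem_biUnion hx (mem_sphereThrough_iff.2 rfl))⟩
  conj_mem z hz := by
    obtain ⟨J, hJ, hzJ⟩ := mem_totalStemDomain_iff.1 hz
    exact mem_totalStemDomain_iff.2 ⟨J, hJ, conj_mem_stemDomain hzJ⟩
  map_conj z hz := by
    obtain ⟨J, hJ, hzJ⟩ := mem_totalStemDomain_iff.1 hz
    rw [gluedStem_eqOn hΩ hf hJ hzJ, gluedStem_eqOn hΩ hf hJ (conj_mem_stemDomain hzJ),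
      stemFamily_conj hΩ.1.2 hf hJ hzJ]
  contDiffOn := contDiffOn_of_isIotaHolomorphicAt (isOpen_totalStemDomain hf.isOpen)
    fun _ hz => isIotaHolomorphicAt_gluedStem hΩ hf hz
  cauchyRiemann _ hz := (isIotaHolomorphicAt_gluedStem hΩ hf hz).2

/-- The slice function induced by a stem function. -/
def inducedFunction (F : ℂ → ComplexifiedQuaternion) (x : ℍ) : ℍ :=
  phiC (unitOf x) (F (upperCoord x))

lemma IsHolomorphicStemOn.isInducedBy {F : ℂ → ComplexifiedQuaternion} {D : Set ℂ}
    (hF : IsHolomorphicStemOn F D) : IsInducedBy (inducedFunction F) F D := by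
  intro J hJ z hz
  rw [inducedFunction, upperCoord_phi hJ]
  rcases lt_trichotomy z.im 0 with h | h | h
  · have h' : 0 < ((starRingEnd ℂ) z).im := by simpa using h
    rw [fold_of_nonpos h.le, hF.map_conj z hz, ← phi_neg_conj,
      unitOf_phi (neg_mem_imaginaryUnits hJ) h']
    simp [phiC, cconj]
  · -- the second component of `F` vanishes at real points, so that the unit does not matter
    have hz' : (starRingEnd ℂ) z = z := Complex.conj_eq_iff_im.2 h
    have h2 := congrArg Prod.snd (hF.map_conj z hz)
    rw [hz'] at h2
    have h3 : (F z).2 = 0 := eq_zero_of_eq_neg h2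
    rw [fold_of_nonneg h.ge]
    simp [phiC, h3]
  · rw [fold_of_nonneg h.le, unitOf_phi hJ h]

/-- Functions induced by holomorphic stem functions are slice regular. -/
lemma IsInducedBy.isSliceRegularOn {g : ℍ → ℍ} {F : ℂ → ComplexifiedQuaternion} {D : Set ℂ}
    {U : Set ℍ} (hF : IsHolomorphicStemOn F D) (hg : IsInducedBy g F D) (hU : IsOpen U)
    (hUD : ∀ J ∈ imaginaryUnits, phi J ⁻¹' U = D) : IsSliceRegularOn g U where
  isOpen := hU
  contDiffOn J hJ := by
    rw [hUD J hJ]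
    have h : ContDiffOn ℝ 1 (fun z => (F z).1 + J * (F z).2) D :=
      hF.contDiffOn.fst.add (contDiffOn_const.mul hF.contDiffOn.snd)
    exact h.congr fun z hz => hg J hJ z hz
  dbar_eq_zero J hJ z hz := by
    rw [hUD J hJ] at hz
    have hFz : HasFDerivAt F (fderiv ℝ F z) z :=
      ((hF.contDiffOn.differentiableOn one_ne_zero).differentiableAt
        (hF.isOpen.mem_nhds hz)).hasFDerivAt
    have h1 : HasFDerivAt (fun w => phiC J (F w)) _ z := hFz.fst.add (hFz.snd.const_mul J)
    have h2 : (g ∘ phi J) =ᶠ[𝓝 z] fun w => phiC J (F w) := by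
      filter_upwards [hF.isOpen.mem_nhds hz] with w hw using hg J hJ w hw
    rw [dbar, h2.fderiv_eq, h1.fderiv]
    have hCR := hF.cauchyRiemann z hz
    simp only [add_apply, smul_apply, ContinuousLinearMap.comp_apply,
      ContinuousLinearMap.coe_fst', ContinuousLinearMap.coe_snd', hCR, iotaMul, smul_eq_mul,
      mul_add, ← mul_assoc J J, mul_self_of_mem hJ]
    simp

/-- A slice regular function on the symmetric completion is determined by its values on `Ω`: along
each slice it is given by a stem function, which is determined by its values at real points. -/
lemma eqOn_symmetricCompletion {f g : ℍ → ℍ} {Ω : Set ℍ} (hΩ : IsSpearedOpen Ω)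
    (hg : IsSliceRegularOn g (symmetricCompletion Ω))
    {F : ℂ → ComplexifiedQuaternion} (hF : ∀ z ∈ totalStemDomain Ω, IsIotaHolomorphicAt F z)
    (hFr : ∀ r : ℝ, (r : ℍ) ∈ Ω → F r = (f r, 0)) (hgf : Set.EqOn g f Ω) {J : ℍ}
    (hJ : J ∈ imaginaryUnits) {z : ℂ} (hz : z ∈ totalStemDomain Ω) :
    g (phi J z) = phiC J (F z) := by
  have hJ' := neg_mem_imaginaryUnits hJ
  have hne : J ≠ -J := fun h => by
    have h0 := norm_of_mem hJ
    rw [eq_zero_of_eq_neg h, norm_zero] at h0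
    exact zero_ne_one h0
  obtain ⟨K, hK, hzK⟩ := mem_totalStemDomain_iff.1 hz
  obtain ⟨r, hr⟩ := exists_real_mem_connectedComponentIn hΩ hK hzK
  have hsub : connectedComponentIn (stemDomain Ω K) z ⊆ totalStemDomain Ω := fun w hw =>
    mem_totalStemDomain_iff.2 ⟨K, hK, connectedComponentIn_subset _ _ hw⟩
  have h := eqOn_of_eq_on_reals (G := upperStem₂ g J (-J)) (H := F)
    (isOpen_stemDomain hΩ.1 K).connectedComponentIn isPreconnected_connectedComponentIn
    (fun w hw => isIotaHolomorphicAt_upperStem₂ hg hJ hJ'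
      ((phi_mem_symmetricCompletion_iff hJ).2 (hsub hw))
      ((phi_mem_symmetricCompletion_iff hJ').2 (hsub hw)))
    (fun w hw => hF w (hsub hw)) hr
    (fun t ht => by
      have htΩ := mem_of_ofReal_mem_stemDomain (connectedComponentIn_subset _ _ ht)
      rw [upperStem₂_ofReal g hne, hFr t htΩ, hgf htΩ])
    (mem_connectedComponentIn hzK)
  rw [← h, phiC_upperStem₂ g hJ hJ' hne]

end

end SliceRegular

open SliceRegular
theorem theorem5 (Ω : Set ℍ) (hΩ : IsHingedDomain Ω) (f : ℍ → ℍ) (hf : IsSliceRegularOn f Ω) :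
    ∃ f' : ℍ → ℍ,
      -- `f'` is the unique slice regular function on the symmetric completion that extends `f`
      IsSliceRegularOn f' (symmetricCompletion Ω) ∧
      Set.EqOn f' f Ω ∧
      (∀ g : ℍ → ℍ, IsSliceRegularOn g (symmetricCompletion Ω) → Set.EqOn g f Ω →
        Set.EqOn g f' (symmetricCompletion Ω)) ∧
      -- and it is induced by one holomorphic stem function that glues the stem family of `f`
      ∃ (FJ : ℍ → ℂ → ComplexifiedQuaternion) (F : ℂ → ComplexifiedQuaternion),
        IsHolomorphicStemFamily Ω f FJ ∧
        IsHolomorphicStemOn F (⋃ J ∈ imaginaryUnits, stemDomain Ω J) ∧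
        (∀ J ∈ imaginaryUnits, Set.EqOn F (FJ J) (stemDomain Ω J)) ∧
        circularization (⋃ J ∈ imaginaryUnits, stemDomain Ω J) = symmetricCompletion Ω ∧
        IsInducedBy f' F (⋃ J ∈ imaginaryUnits, stemDomain Ω J) := by
  have hF := isHolomorphicStemOn_gluedStem hΩ hf
  have hind := hF.isInducedBy
  refine ⟨inducedFunction (gluedStem Ω f), ?_, ?_, ?_, stemFamily f, gluedStem Ω f,
    isHolomorphicStemFamily_stemFamily hΩ.1 hf, hF, fun J hJ => gluedStem_eqOn hΩ hf hJ,
    circularization_totalStemDomain Ω, hind⟩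
  · refine hind.isSliceRegularOn hF (isOpen_symmetricCompletion hf.isOpen) fun J hJ => ?_
    ext z
    exact phi_mem_symmetricCompletion_iff hJ
  · intro x hx
    have h0 := upperCoord_im_nonneg x
    have hxΩ : phi (unitOf x) (upperCoord x) ∈ Ω := by rwa [phi_unitOf_upperCoord]
    have hxD : upperCoord x ∈ stemDomain Ω (unitOf x) := Or.inl ⟨h0, hxΩ⟩
    rw [inducedFunction, gluedStem_eqOn hΩ hf (unitOf_mem x) hxD,
      phiC_stemFamily hΩ.1.2 hf (unitOf_mem x) h0 hxΩ, phi_unitOf_upperCoord]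
  · intro g hg hgf x hx
    have h := eqOn_symmetricCompletion hΩ.1.2 hg
      (fun z hz => isIotaHolomorphicAt_gluedStem hΩ hf hz) (fun r hr => by
        have hrD : (r : ℂ) ∈ stemDomain Ω (unitOf 0) := by
          rwa [mem_stemDomain_iff, fold_ofReal, phi_ofReal]
        rw [gluedStem_eqOn hΩ hf (unitOf_mem 0) hrD,
          stemFamily_ofReal hΩ.1.2 hf (unitOf_mem 0) hrD])
      hgf (unitOf_mem x) (mem_symmetricCompletion_iff.1 hx)
    rwa [phi_unitOf_upperCoord] at h
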